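/- **Theorem 6.12 (Noether's theorem, Hamiltonian version).** Let $(X,\omega,H)$ be a Hamiltonian system: $X$ is a smooth finite-dimensional manifold without boundary, $\omega$ is a symplectic form on $X$ (a smooth, closed $2$-form that is non-degenerate at every point), and $H\in C^\infty(X)$. For a smooth function $f$, let $V_f$ denote its Hamiltonian vector field, the unique vector field with $V_f\lrcorner\,\omega=\omega(V_f,\cdot)=df$, and let $\{f,g\}=\omega(V_f,V_g)$ be the Poisson bracket. These definitions also apply to functions that are smooth on an open subset of $X$. A *continuous symmetry* is a smooth vector field $W$ on $X$ with $\mathcal L_W\omega=0$ and $\mathcal L_WH=0$, where $\mathcal L$ is the Lie derivative. 1. Let $W$ be a continuous symmetry. Then $W$ is locally Hamiltonian: every $p\in X$ has an open neighbourhood $U$ with a function $f\in C^\infty(U)$ such that $W\lrcorner\,\omega=df$ on $U$. Moreover, for every open $U\subseteq X$ and every $f\in C^\infty(U)$ with $W\lrcorner\,\omega=df$ on $U$, we have $W=V_f$ and $\{f,H\}=0$ on $U$. 2. Conversely, if $f\in C^\infty(X)$ satisfies $\{f,H\}=0$ on $X$, then $V_f$ is a continuous symmetry; that is, $V_f$ is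 a smooth vector field with $\mathcal L_{V_f}\omega=0$ and $\mathcal L_{V_f}H=0$. -/

import Mathlib

open scoped Manifold ContDiff

noncomputable section

namespace HamiltonianMechanics

/-! Manifolds are smooth, finite-dimensional and without boundary: `X` is charted on the
finite-dimensional real normed space `E`, with the model `𝓘(ℝ, E)`. -/

section Forms

variable (E : Type*) [NormedAddCommGroup E] [NormedSpace ℝ E]
  (X : Type*) [TopologicalSpace X] [ChartedSpace E X]

/-- A (not necessarily continuous) vector field on `X`. -/
abbrev VField : Type _ := (x : X) → TangentSpace 𝓘(ℝ, E) x

/-- A (not necessarily continuous) differential `k`-form on `X`. -/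
abbrev DForm (k : ℕ) : Type _ := (x : X) → TangentSpace 𝓘(ℝ, E) x [⋀^Fin k]→L[ℝ] ℝ

variable {E X}

/-- The vector field `W` is smooth at `x`, as a section of the tangent bundle. -/
def VField.SmoothAt [IsManifold 𝓘(ℝ, E) ∞ X] (W : VField E X) (x : X) : Prop :=
  ContMDiffAt 𝓘(ℝ, E) 𝓘(ℝ, E).tangent ∞
    (fun y ↦ (⟨y, W y⟩ : TangentBundle 𝓘(ℝ, E) X)) x

/-- `W ∈ Γ(TX)`: the vector field `W` is smooth. -/
def VField.Smooth [IsManifold 𝓘(ℝ, E) ∞ X] (W : VField E X) : Prop :=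
  ∀ x, W.SmoothAt x

/-- The `k`-form on the model space `E` that represents the `k`-form `σ` in the chart of `X` at
`x₀`, that is, the pullback of `σ` under the inverse of this chart (relevant only on the target of
the chart). Here `NormedSpace.fromTangentSpace y` is the identification of the tangent space of `E`
at `y` with `E`. -/
def DForm.inChart {k : ℕ} (σ : DForm E X k) (x₀ : X) : E → E [⋀^Fin k]→L[ℝ] ℝ := fun y ↦
  (σ ((extChartAt 𝓘(ℝ, E) x₀).symm y)).compContinuousLinearMap
    ((mfderiv 𝓘(ℝ, E) 𝓘(ℝ, E) (extChartAt 𝓘(ℝ, E) x₀).symm y).comp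
      (NormedSpace.fromTangentSpace y).symm.toContinuousLinearMap)

/-- `σ ∈ Ω^k(X)`: the form `σ` is smooth, that is, its coefficients are smooth in charts. -/
def DForm.Smooth {k : ℕ} (σ : DForm E X k) : Prop :=
  ∀ x₀ : X, ContDiffOn ℝ ∞ (σ.inChart x₀) (extChartAt 𝓘(ℝ, E) x₀).target

/-- The exterior derivative of a `k`-form on a manifold: at `x`, it is the pullback under the chart
at `x` of the exterior derivative of the form that represents `σ` in this chart. -/
def DForm.d {k : ℕ} (σ : DForm E X k) : DForm E X (k + 1) := fun x ↦
  (extDeriv (σ.inChart x) (extChartAt 𝓘(ℝ, E) x x)).compContinuousLinearMap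
    ((NormedSpace.fromTangentSpace (extChartAt 𝓘(ℝ, E) x x)).toContinuousLinearMap.comp
      (mfderiv 𝓘(ℝ, E) 𝓘(ℝ, E) (extChartAt 𝓘(ℝ, E) x) x))

/-- The differential `df` of a function at `x`, as a covector. -/
def diff (f : X → ℝ) (x : X) : TangentSpace 𝓘(ℝ, E) x →L[ℝ] ℝ := mvfderiv 𝓘(ℝ, E) f x

/-- The value `(L_W σ)(Y₁, …, Y_k)` of the Lie derivative of the `k`-form `σ` along `W` on the
vector fields `Y₁, …, Y_k`:
`(L_W σ)(Y₁, …, Y_k) = W (σ(Y₁, …, Y_k)) - ∑ i, σ(Y₁, …, [W, Y_i], …, Y_k)`. -/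
def lieDeriv {k : ℕ} (W : VField E X) (σ : DForm E X k) (Y : Fin k → VField E X) (x : X) : ℝ :=
  diff (fun y ↦ σ y (fun i ↦ Y i y)) x (W x) -
    ∑ i, σ x (Function.update (fun j ↦ Y j x) i (VectorField.mlieBracket 𝓘(ℝ, E) W (Y i) x))

/-- `L_W σ = 0`: the Lie derivative of `σ` along `W` vanishes at every point, on all vector fields
that are smooth there. -/
def LieDerivEqZero [IsManifold 𝓘(ℝ, E) ∞ X] {k : ℕ} (W : VField E X) (σ : DForm E X k) : Prop :=
  ∀ (x : X) (Y : Fin k → VField E X), (∀ i, (Y i).SmoothAt x) → lieDeriv W σ Y x = 0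

/-- The Lie derivative `L_W f = W f = df(W)` of a function. -/
def lieDerivFun (W : VField E X) (f : X → ℝ) (x : X) : ℝ := diff f x (W x)

end Forms

section Symplectic

variable (E : Type*) [NormedAddCommGroup E] [NormedSpace ℝ E]
  (X : Type*) [TopologicalSpace X] [ChartedSpace E X]

/-- A symplectic form on `X`: a smooth, closed, pointwise non-degenerate `2`-form. -/
structure SymplecticForm where
  form : DForm E X 2
  smooth : form.Smooth
  closed : form.d = 0
  nondegenerate : ∀ (x : X) (u : TangentSpace 𝓘(ℝ, E) x),
    (∀ v : TangentSpace 𝓘(ℝ, E) x, form x ![u, v] = 0) → u = 0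

variable {E X}

namespace SymplecticForm

theorem update_pair {V : Type*} [Zero V] (u w : V) : Function.update ![u, 0] 1 w = ![u, w] := by
  ext i
  fin_cases i <;> rfl

theorem update_pair_zero {V : Type*} [Zero V] (u w : V) :
    Function.update ![0, w] 0 u = ![u, w] := by
  ext i
  fin_cases i <;> rfl

/-- The interior product `u ⌟ σ_x = σ_x(u, ·)` of a tangent vector with the symplectic form, as a
linear map in `u`. -/
def interior (σ : SymplecticForm E X) (x : X) :
    TangentSpace 𝓘(ℝ, E) x →ₗ[ℝ] (TangentSpace 𝓘(ℝ, E) x →L[ℝ] ℝ) where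
  toFun u := (σ.form x).toContinuousLinearMap ![u, 0] 1
  map_add' u v := by
    ext w
    have h := (σ.form x).map_update_add ![0, w] 0 u v
    rw [update_pair_zero, update_pair_zero, update_pair_zero] at h
    simpa [update_pair] using h
  map_smul' c u := by
    ext w
    have h := (σ.form x).map_update_smul ![0, w] 0 c u
    rw [update_pair_zero, update_pair_zero] at h
    simpa [update_pair] using h

theorem interior_apply (σ : SymplecticForm E X) (x : X) (u v : TangentSpace 𝓘(ℝ, E) x) :
    σ.interior x u v = σ.form x ![u, v] := by
  simp [interior, update_pair]

theorem interior_bijective [FiniteDimensional ℝ E] (σ : SymplecticForm E X) (x : X) :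
    Function.Bijective (σ.interior x) := by
  have : FiniteDimensional ℝ (TangentSpace 𝓘(ℝ, E) x) := inferInstanceAs (FiniteDimensional ℝ E)
  have hinj : Function.Injective (σ.interior x) := by
    rw [← LinearMap.ker_eq_bot, LinearMap.ker_eq_bot']
    intro u hu
    refine σ.nondegenerate x u fun v ↦ ?_
    rw [← interior_apply, hu]
    rfl
  have hdim : Module.finrank ℝ (TangentSpace 𝓘(ℝ, E) x) =
      Module.finrank ℝ (TangentSpace 𝓘(ℝ, E) x →L[ℝ] ℝ) :=
    (Subspace.dual_finrank_eq (K := ℝ) (V := E)).symm.trans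
      (LinearMap.toContinuousLinearMap (𝕜 := ℝ) (E := E) (F' := ℝ)).finrank_eq
  have : FiniteDimensional ℝ (TangentSpace 𝓘(ℝ, E) x →L[ℝ] ℝ) :=
    inferInstanceAs (FiniteDimensional ℝ (E →L[ℝ] ℝ))
  exact ⟨hinj, (LinearMap.injective_iff_surjective_of_finrank_eq_finrank hdim).1 hinj⟩

/-- The symplectic dual of a covector `μ` at `x`: the unique tangent vector `V` at `x` with
`V ⌟ σ = μ`. -/
def dual [FiniteDimensional ℝ E] (σ : SymplecticForm E X) (x : X)
    (μ : TangentSpace 𝓘(ℝ, E) x →L[ℝ] ℝ) : TangentSpace 𝓘(ℝ, E) x :=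
  (LinearEquiv.ofBijective (σ.interior x) (σ.interior_bijective x)).symm μ

/-- The Hamiltonian vector field `V_f`, the symplectic dual of `df`. -/
def hamVField [FiniteDimensional ℝ E] (σ : SymplecticForm E X) (f : X → ℝ) : VField E X :=
  fun x ↦ σ.dual x (diff f x)

/-- The Poisson bracket `{f, g} = σ(V_f, V_g)`. -/
def poisson [FiniteDimensional ℝ E] (σ : SymplecticForm E X) (f g : X → ℝ) (x : X) : ℝ :=
  σ.form x ![σ.hamVField f x, σ.hamVField g x]

/-- `f` is a Hamiltonian function of the vector field `W` on the open set `U`: `f ∈ C^∞(U)` and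
`W ⌟ σ = df` on `U`. Values of `f` outside of `U` are irrelevant. -/
structure IsHamiltonianFunctionOn (σ : SymplecticForm E X) (W : VField E X) (f : X → ℝ)
    (U : Set X) : Prop where
  isOpen : IsOpen U
  smooth : ContMDiffOn 𝓘(ℝ, E) 𝓘(ℝ, ℝ) ∞ f U
  interior_eq : ∀ x ∈ U, σ.interior x (W x) = diff f x

/-- `W` is locally Hamiltonian: around every point it has a Hamiltonian function. -/
def IsLocallyHamiltonian (σ : SymplecticForm E X) (W : VField E X) : Prop :=
  ∀ p : X, ∃ (U : Set X) (f : X → ℝ), p ∈ U ∧ σ.IsHamiltonianFunctionOn W f U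

/-- `W` is a continuous symmetry of the Hamiltonian system `(X, σ, H)`: a smooth vector field with
`L_W σ = 0` and `L_W H = 0`. -/
structure IsContinuousSymmetry [IsManifold 𝓘(ℝ, E) ∞ X] (σ : SymplecticForm E X) (H : X → ℝ)
    (W : VField E X) : Prop where
  smooth : W.Smooth
  lieDeriv_form : LieDerivEqZero W σ.form
  lieDeriv_fun : ∀ x, lieDerivFun W H x = 0

end SymplecticForm

end Symplectic

end HamiltonianMechanics

end

/-! Since `dσ = 0`, Cartan's formula reads `L_W σ = d(W ⌟ σ)`, so a smooth `W` preserves `σ` exactly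
when the `1`-form `W ⌟ σ` is closed. The Poincaré lemma on a ball in a chart then gives a local
primitive `f`, and non-degeneracy forces `W = V_f` wherever `W ⌟ σ = df`. Conversely, `V_f ⌟ σ = df`
is always closed. Antisymmetry gives `{f, H} = -dH(V_f)` (`poisson_eq`), so `{f, H} = 0` and
`L_{V_f} H = 0` are the same condition.

The analysis takes place in charts, where a `1`-form is closed when its Fréchet derivative is
symmetric. `lieDerivEqZero_iff` is Cartan's formula at the centre of each chart.
`fderiv_contraction_symmetric` carries the symmetry to all other points of a chart, as the Poincaré
lemma requires. Smoothness of `V_f` comes from smoothness of operator inversion. -/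

open scoped Topology

namespace HamiltonianMechanics

/-! ### Calculus of `1`- and `2`-forms on a normed space -/

section NormedSpace

variable {E F : Type*} [NormedAddCommGroup E] [NormedSpace ℝ E]
  [NormedAddCommGroup F] [NormedSpace ℝ F]

/-- An alternating `2`-form, seen as a bilinear map. -/
noncomputable def bilin : (E [⋀^Fin 2]→L[ℝ] ℝ) →L[ℝ] E →L[ℝ] E →L[ℝ] ℝ :=
  (ContinuousLinearMap.compL ℝ E (ContinuousMultilinearMap ℝ (fun _ : Fin 1 ↦ E) ℝ) (E →L[ℝ] ℝ)
      (continuousMultilinearCurryFin1 ℝ E ℝ :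
        ContinuousMultilinearMap ℝ (fun _ : Fin 1 ↦ E) ℝ →L[ℝ] E →L[ℝ] ℝ)).comp
    ((continuousMultilinearCurryLeftEquiv ℝ (fun _ : Fin 2 ↦ E) ℝ :
        ContinuousMultilinearMap ℝ (fun _ : Fin 2 ↦ E) ℝ →L[ℝ] _).comp
      (ContinuousAlternatingMap.toContinuousMultilinearMapCLM ℝ))

@[simp]
theorem bilin_apply (η : E [⋀^Fin 2]→L[ℝ] ℝ) (u v : E) : bilin η u v = η ![u, v] := by
  simp only [bilin, ContinuousLinearMap.comp_apply]
  change η _ = η _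
  congr 1
  ext i
  fin_cases i <;> rfl

theorem bilin_apply' (η : E [⋀^Fin 2]→L[ℝ] ℝ) (v : Fin 2 → E) : η v = bilin η (v 0) (v 1) := by
  rw [bilin_apply]
  congr 1
  ext i
  fin_cases i <;> rfl

theorem bilin_swap (η : E [⋀^Fin 2]→L[ℝ] ℝ) (u v : E) : bilin η u v = -bilin η v u := by
  have h : η (![v, u] ∘ Equiv.swap 0 1) = -η ![v, u] :=
    η.toAlternatingMap.map_swap ![v, u] (by decide)
  rw [bilin_apply, bilin_apply, ← h]
  congr 1
  ext i
  fin_cases i <;> rfl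

theorem hasFDerivAt_bilin {η : E → E [⋀^Fin 2]→L[ℝ] ℝ} {p : E} (hη : DifferentiableAt ℝ η p) :
    HasFDerivAt (fun y ↦ bilin (η y)) (bilin.comp (fderiv ℝ η p)) p := by
  have h : HasFDerivAt (bilin (E := E)) bilin (η p) := ContinuousLinearMap.hasFDerivAt _
  exact HasFDerivAt.comp (g := bilin) (f := η) p h hη.hasFDerivAt

theorem extDeriv_two_apply (η : E → E [⋀^Fin 2]→L[ℝ] ℝ) (p a b c : E) :
    extDeriv η p ![a, b, c] = bilin (fderiv ℝ η p a) b c + bilin (fderiv ℝ η p b) c a +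
      bilin (fderiv ℝ η p c) a b := by
  have h (ξ : E [⋀^Fin 2]→L[ℝ] ℝ) (i : Fin 3) (v : Fin 3 → E) :
      ξ (i.removeNth v) = bilin ξ (v (i.succAbove 0)) (v (i.succAbove 1)) := bilin_apply' ξ _
  rw [extDeriv, ContinuousAlternatingMap.alternatizeUncurryFin_apply, Fin.sum_univ_three,
    bilin_swap _ c a, h, h, h]
  simp [Fin.succAbove, -bilin_apply]

/-- Cartan's formula for the Lie derivative of a closed `2`-form on a vector space. -/
theorem lieDeriv_formula {η : E → E [⋀^Fin 2]→L[ℝ] ℝ} {W : E → E} {Y : Fin 2 → E → E} {p : E}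
    (hη : DifferentiableAt ℝ η p) (hW : DifferentiableAt ℝ W p)
    (hY : ∀ i, DifferentiableAt ℝ (Y i) p) (hd : extDeriv η p = 0) :
    fderiv ℝ (fun y ↦ η y (fun i ↦ Y i y)) p (W p) -
      ∑ i, η p (Function.update (fun j ↦ Y j p) i (VectorField.lieBracket ℝ W (Y i) p)) =
    fderiv ℝ (fun y ↦ bilin (η y) (W y)) p (Y 0 p) (Y 1 p) -
      fderiv ℝ (fun y ↦ bilin (η y) (W y)) p (Y 1 p) (Y 0 p) := by
  have hB : HasFDerivAt (fun y ↦ bilin (η y)) (bilin.comp (fderiv ℝ η p)) p :=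
    hasFDerivAt_bilin hη
  have h1 := (hB.clm_apply (hY 0).hasFDerivAt).clm_apply (hY 1).hasFDerivAt
  have h2 := hB.clm_apply hW.hasFDerivAt
  have h3 : (fun y ↦ η y (fun i ↦ Y i y)) = fun y ↦ bilin (η y) (Y 0 y) (Y 1 y) := by
    ext y
    rw [bilin_apply']
  have h4 := extDeriv_two_apply η p (W p) (Y 0 p) (Y 1 p)
  rw [hd] at h4
  rw [h3, h1.fderiv, h2.fderiv, Fin.sum_univ_two, bilin_apply' _ (Function.update _ _ _),
    bilin_apply' _ (Function.update _ _ _)]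
  -- The derivatives of `Y 0` and `Y 1` cancel against the brackets; the two sides then differ by
  -- `dη(W, Y 0, Y 1)`, which `h4` says is zero.
  simp [VectorField.lieBracket, -bilin_apply] at h4 ⊢
  rw [bilin_swap (fderiv ℝ η p (Y 0 p)) (W p), bilin_swap _ (fderiv ℝ W p (Y 1 p))]
  linarith

/-- Closedness of `1`-forms is preserved under pullback. -/
theorem fderiv_pullback_symmetric {α : E → E →L[ℝ] ℝ} {β : F → F →L[ℝ] ℝ} {τ : E → F} {p : E}
    (hτ : ContDiffAt ℝ 2 τ p) (hβ : DifferentiableAt ℝ β (τ p))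
    (hαβ : α =ᶠ[𝓝 p] fun y ↦ (β (τ y)).comp (fderiv ℝ τ y))
    (hsymm : ∀ u v, fderiv ℝ β (τ p) u v = fderiv ℝ β (τ p) v u) (u v : E) :
    fderiv ℝ α p u v = fderiv ℝ α p v u := by
  have h1 : HasFDerivAt (fun y ↦ β (τ y)) ((fderiv ℝ β (τ p)).comp (fderiv ℝ τ p)) p :=
    hβ.hasFDerivAt.comp p (hτ.differentiableAt (by simp)).hasFDerivAt
  have h2 : DifferentiableAt ℝ (fderiv ℝ τ) p :=
    (hτ.fderiv_right (m := 1) (by norm_num)).differentiableAt (by simp)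
  have h3 := hτ.isSymmSndFDerivAt (by simp)
  rw [hαβ.fderiv_eq, (h1.clm_comp h2.hasFDerivAt).fderiv]
  -- The derivative of the pullback is `Dβ(τ'u)(τ'v) + β(τ''(u, v))`: the first term is symmetric by
  -- hypothesis, the second by symmetry of second derivatives.
  have h4 := h3 u v
  simp [hsymm (fderiv ℝ τ p u), h4]

end NormedSpace

/-! ### Vector fields, forms and Lie derivatives in charts -/

section Charts

variable {E : Type*} [NormedAddCommGroup E] [NormedSpace ℝ E]
  {X : Type*} [TopologicalSpace X] [ChartedSpace E X] {x₀ : X}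

/-- The vector field on the model space that represents `W` in the chart of `X` at `x₀`. -/
noncomputable def VField.inChart (W : VField E X) (x₀ : X) : E → E := fun y ↦
  mfderiv 𝓘(ℝ, E) 𝓘(ℝ, E) (extChartAt 𝓘(ℝ, E) x₀) ((extChartAt 𝓘(ℝ, E) x₀).symm y)
    (W ((extChartAt 𝓘(ℝ, E) x₀).symm y))

theorem VField.inChart_apply (W : VField E X) {x : X}
    (hx : x ∈ (extChartAt 𝓘(ℝ, E) x₀).source) :
    W.inChart x₀ (extChartAt 𝓘(ℝ, E) x₀ x) =
      mfderiv 𝓘(ℝ, E) 𝓘(ℝ, E) (extChartAt 𝓘(ℝ, E) x₀) x (W x) := by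
  -- Substituting for `x` also changes the point in the type of the tangent space, which rewriting
  -- could not do.
  obtain ⟨y, hy, rfl⟩ : ∃ y ∈ (extChartAt 𝓘(ℝ, E) x₀).target,
      (extChartAt 𝓘(ℝ, E) x₀).symm y = x :=
    ⟨_, (extChartAt 𝓘(ℝ, E) x₀).map_source hx, (extChartAt 𝓘(ℝ, E) x₀).left_inv hx⟩
  exact congrArg (W.inChart x₀) ((extChartAt 𝓘(ℝ, E) x₀).right_inv hy)

theorem DForm.Smooth.contDiffAt {k : ℕ} {σ : DForm E X k} (hσ : σ.Smooth) {y : E}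
    (hy : y ∈ (extChartAt 𝓘(ℝ, E) x₀).target) : ContDiffAt ℝ ∞ (σ.inChart x₀) y :=
  (hσ x₀).contDiffAt ((isOpen_extChartAt_target x₀).mem_nhds hy)

variable [IsManifold 𝓘(ℝ, E) ∞ X]

theorem mfderiv_symm_mfderiv {y : E} (hy : y ∈ (extChartAt 𝓘(ℝ, E) x₀).target)
    (v : TangentSpace 𝓘(ℝ, E) ((extChartAt 𝓘(ℝ, E) x₀).symm y)) :
    mfderiv 𝓘(ℝ, E) 𝓘(ℝ, E) (extChartAt 𝓘(ℝ, E) x₀).symm y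
      (mfderiv 𝓘(ℝ, E) 𝓘(ℝ, E) (extChartAt 𝓘(ℝ, E) x₀) ((extChartAt 𝓘(ℝ, E) x₀).symm y) v) =
      v := by
  have h := mfderivWithin_extChartAt_symm_comp_mfderiv_extChartAt (I := 𝓘(ℝ, E)) hy
  rw [ModelWithCorners.Boundaryless.range_eq_univ, mfderivWithin_univ] at h
  exact DFunLike.congr_fun h v

theorem mfderiv_mfderiv_symm {y : E} (hy : y ∈ (extChartAt 𝓘(ℝ, E) x₀).target) (v : E) :
    mfderiv 𝓘(ℝ, E) 𝓘(ℝ, E) (extChartAt 𝓘(ℝ, E) x₀) ((extChartAt 𝓘(ℝ, E) x₀).symm y)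
      (mfderiv 𝓘(ℝ, E) 𝓘(ℝ, E) (extChartAt 𝓘(ℝ, E) x₀).symm y v) = v := by
  have h := mfderiv_extChartAt_comp_mfderivWithin_extChartAt_symm (I := 𝓘(ℝ, E)) hy
  rw [ModelWithCorners.Boundaryless.range_eq_univ, mfderivWithin_univ] at h
  exact DFunLike.congr_fun h v

theorem isInvertible_mfderiv_symm {y : E} (hy : y ∈ (extChartAt 𝓘(ℝ, E) x₀).target) :
    (mfderiv 𝓘(ℝ, E) 𝓘(ℝ, E) (extChartAt 𝓘(ℝ, E) x₀).symm y).IsInvertible := by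
  have h := isInvertible_mfderivWithin_extChartAt_symm (I := 𝓘(ℝ, E)) hy
  rwa [ModelWithCorners.Boundaryless.range_eq_univ, mfderivWithin_univ] at h

theorem contMDiffAt_symm {y : E} (hy : y ∈ (extChartAt 𝓘(ℝ, E) x₀).target) :
    ContMDiffAt 𝓘(ℝ, E) 𝓘(ℝ, E) ∞ (extChartAt 𝓘(ℝ, E) x₀).symm y :=
  (contMDiffOn_extChartAt_symm x₀).contMDiffAt ((isOpen_extChartAt_target x₀).mem_nhds hy)

theorem contMDiffAt_chart {x : X} (hx : x ∈ (extChartAt 𝓘(ℝ, E) x₀).source) :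
    ContMDiffAt 𝓘(ℝ, E) 𝓘(ℝ, E) ∞ (extChartAt 𝓘(ℝ, E) x₀) x :=
  contMDiffAt_extChartAt' (by rwa [extChartAt_source] at hx)

theorem VField.mpullback_eq_inChart (W : VField E X) {y : E}
    (hy : y ∈ (extChartAt 𝓘(ℝ, E) x₀).target) :
    VectorField.mpullback 𝓘(ℝ, E) 𝓘(ℝ, E) (extChartAt 𝓘(ℝ, E) x₀).symm W y =
      W.inChart x₀ y :=
  (isInvertible_mfderiv_symm hy).inverse_apply_eq.2 (mfderiv_symm_mfderiv hy _).symm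

theorem VField.SmoothAt.inChart [CompleteSpace E] {W : VField E X} {y : E}
    (hy : y ∈ (extChartAt 𝓘(ℝ, E) x₀).target)
    (hW : W.SmoothAt ((extChartAt 𝓘(ℝ, E) x₀).symm y)) :
    ContDiffAt ℝ ∞ (W.inChart x₀) y := by
  have h := ContMDiffAt.mpullback_vectorField_preimage (n := ∞) hW (contMDiffAt_symm hy)
    (isInvertible_mfderiv_symm hy) (by simp)
  refine (contMDiffAt_vectorSpace_iff_contDiffAt.1 h).congr_of_eventuallyEq ?_
  filter_upwards [(isOpen_extChartAt_target x₀).mem_nhds hy] with z hz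
  exact (W.mpullback_eq_inChart hz).symm

theorem DForm.inChart_mfderiv {k : ℕ} (σ : DForm E X k) {x : X}
    (hx : x ∈ (extChartAt 𝓘(ℝ, E) x₀).source) (v : Fin k → TangentSpace 𝓘(ℝ, E) x) :
    σ.inChart x₀ (extChartAt 𝓘(ℝ, E) x₀ x)
      (fun i ↦ mfderiv 𝓘(ℝ, E) 𝓘(ℝ, E) (extChartAt 𝓘(ℝ, E) x₀) x (v i)) = σ x v := by
  obtain ⟨y, hy, rfl⟩ : ∃ y ∈ (extChartAt 𝓘(ℝ, E) x₀).target,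
      (extChartAt 𝓘(ℝ, E) x₀).symm y = x :=
    ⟨_, (extChartAt 𝓘(ℝ, E) x₀).map_source hx, (extChartAt 𝓘(ℝ, E) x₀).left_inv hx⟩
  have h := congrArg (σ.inChart x₀) ((extChartAt 𝓘(ℝ, E) x₀).right_inv hy)
  refine (DFunLike.congr_fun h _).trans ?_
  exact congrArg (σ _) (funext fun i ↦ mfderiv_symm_mfderiv hy (v i))

theorem diff_comp_chart {f : X → ℝ} {g : E → ℝ} {x : X}
    (hx : x ∈ (extChartAt 𝓘(ℝ, E) x₀).source)
    (hfg : f =ᶠ[𝓝 x] g ∘ extChartAt 𝓘(ℝ, E) x₀)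
    (hg : DifferentiableAt ℝ g (extChartAt 𝓘(ℝ, E) x₀ x)) (v : TangentSpace 𝓘(ℝ, E) x) :
    diff f x v = fderiv ℝ g (extChartAt 𝓘(ℝ, E) x₀ x)
      (mfderiv 𝓘(ℝ, E) 𝓘(ℝ, E) (extChartAt 𝓘(ℝ, E) x₀) x v) := by
  have h : mfderiv 𝓘(ℝ, E) 𝓘(ℝ, ℝ) (g ∘ extChartAt 𝓘(ℝ, E) x₀) x =
      (mfderiv 𝓘(ℝ, E) 𝓘(ℝ, ℝ) g (extChartAt 𝓘(ℝ, E) x₀ x)).comp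
        (mfderiv 𝓘(ℝ, E) 𝓘(ℝ, E) (extChartAt 𝓘(ℝ, E) x₀) x) :=
    mfderiv_comp x hg.mdifferentiableAt ((contMDiffAt_chart hx).mdifferentiableAt (by simp))
  rw [mfderiv_eq_fderiv] at h
  have h' := hfg.mfderiv_eq (I := 𝓘(ℝ, E)) (I' := 𝓘(ℝ, ℝ))
  change mfderiv 𝓘(ℝ, E) 𝓘(ℝ, ℝ) f x v = _
  exact (DFunLike.congr_fun h' v).trans (DFunLike.congr_fun h v)

/-- The Lie bracket of vector fields, computed in a chart. -/
theorem mfderiv_mlieBracket (W Y : VField E X) (x : X) :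
    mfderiv 𝓘(ℝ, E) 𝓘(ℝ, E) (extChartAt 𝓘(ℝ, E) x) x
        (VectorField.mlieBracket 𝓘(ℝ, E) W Y x) =
      VectorField.lieBracket ℝ (W.inChart x) (Y.inChart x) (extChartAt 𝓘(ℝ, E) x x) := by
  have hp := mem_extChartAt_target (I := 𝓘(ℝ, E)) x
  have hev (V : VField E X) :
      VectorField.mpullback 𝓘(ℝ, E) 𝓘(ℝ, E) (extChartAt 𝓘(ℝ, E) x).symm V
        =ᶠ[𝓝 (extChartAt 𝓘(ℝ, E) x x)] V.inChart x := by
    filter_upwards [(isOpen_extChartAt_target x).mem_nhds hp] with z hz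
    exact V.mpullback_eq_inChart hz
  have h := VectorField.mlieBracketWithin_apply (I := 𝓘(ℝ, E)) (V := W) (W := Y)
    (s := Set.univ) (x₀ := x)
  simp only [ModelWithCorners.Boundaryless.range_eq_univ, Set.preimage_univ, Set.univ_inter,
    VectorField.mpullbackWithin_univ, VectorField.mlieBracketWithin_univ] at h
  have hinv := isInvertible_mfderiv_extChartAt (I := 𝓘(ℝ, E)) (mem_extChartAt_source x)
  refine (hinv.inverse_apply_eq.1 h.symm).symm.trans ?_
  refine (congrFun (VectorField.lieBracketWithin_univ (𝕜 := ℝ) (E := E)) _).trans ?_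
  exact Filter.EventuallyEq.lieBracket_vectorField_eq (hev W) (hev Y)

/-- The Lie derivative of a form, computed in a chart. -/
theorem lieDeriv_eq_inChart [CompleteSpace E] {k : ℕ} {σ : DForm E X k} (hσ : σ.Smooth) {W : VField E X}
    {Y : Fin k → VField E X} {x : X} (hY : ∀ i, (Y i).SmoothAt x) :
    lieDeriv W σ Y x =
      fderiv ℝ (fun y ↦ σ.inChart x y (fun i ↦ (Y i).inChart x y)) (extChartAt 𝓘(ℝ, E) x x)
          (W.inChart x (extChartAt 𝓘(ℝ, E) x x)) -
        ∑ i, σ.inChart x (extChartAt 𝓘(ℝ, E) x x)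
          (Function.update (fun j ↦ (Y j).inChart x (extChartAt 𝓘(ℝ, E) x x)) i
            (VectorField.lieBracket ℝ (W.inChart x) ((Y i).inChart x)
              (extChartAt 𝓘(ℝ, E) x x))) := by
  have hx := mem_extChartAt_source (I := 𝓘(ℝ, E)) x
  have hp := mem_extChartAt_target (I := 𝓘(ℝ, E)) x
  have hY' (i) : DifferentiableAt ℝ ((Y i).inChart x) (extChartAt 𝓘(ℝ, E) x x) := by
    refine (VField.SmoothAt.inChart hp ?_).differentiableAt (by simp)
    rw [extChartAt_to_inv]
    exact hY i
  unfold lieDeriv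
  congr 1
  · rw [W.inChart_apply hx]
    refine diff_comp_chart hx ?_ ?_ _
    · filter_upwards [extChartAt_source_mem_nhds (I := 𝓘(ℝ, E)) x] with z hz
      rw [Function.comp_apply, ← σ.inChart_mfderiv hz]
      congr 1
      ext i
      exact ((Y i).inChart_apply hz).symm
    · have h := (hσ.contDiffAt hp).differentiableAt (by simp)
      exact h.continuousAlternatingMap_apply hY'
  · refine Finset.sum_congr rfl fun i _ ↦ ?_
    rw [← σ.inChart_mfderiv hx]
    congr 1
    ext j
    by_cases h : j = i
    · subst h
      simp only [Function.update_self]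
      exact mfderiv_mlieBracket _ _ _
    · simp only [Function.update_of_ne h]
      exact ((Y j).inChart_apply hx).symm

end Charts

/-! ### Closedness of `W ⌟ σ` and local Hamiltonian functions -/

section Contraction

variable {E : Type*} [NormedAddCommGroup E] [NormedSpace ℝ E]
  {X : Type*} [TopologicalSpace X] [ChartedSpace E X] {x₀ : X}

namespace SymplecticForm

/-- The `1`-form `W ⌟ σ`, in the chart of `X` at `x₀`. -/
noncomputable def contraction (σ : SymplecticForm E X) (W : VField E X) (x₀ : X) :
    E → E →L[ℝ] ℝ :=
  fun y ↦ bilin (σ.form.inChart x₀ y) (W.inChart x₀ y)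

theorem contDiffAt_bilin_inChart (σ : SymplecticForm E X) {y : E}
    (hy : y ∈ (extChartAt 𝓘(ℝ, E) x₀).target) :
    ContDiffAt ℝ ∞ (fun z ↦ bilin (σ.form.inChart x₀ z)) y := by
  have h : ContDiffAt ℝ ∞ (bilin (E := E)) (σ.form.inChart x₀ y) :=
    (ContinuousLinearMap.contDiff _).contDiffAt
  exact ContDiffAt.comp (g := bilin) (f := σ.form.inChart x₀) y h (σ.smooth.contDiffAt hy)

variable [IsManifold 𝓘(ℝ, E) ∞ X]

theorem bilin_inChart_mfderiv (σ : SymplecticForm E X) {x : X}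
    (hx : x ∈ (extChartAt 𝓘(ℝ, E) x₀).source) (u v : TangentSpace 𝓘(ℝ, E) x) :
    bilin (σ.form.inChart x₀ (extChartAt 𝓘(ℝ, E) x₀ x))
      (mfderiv 𝓘(ℝ, E) 𝓘(ℝ, E) (extChartAt 𝓘(ℝ, E) x₀) x u)
      (mfderiv 𝓘(ℝ, E) 𝓘(ℝ, E) (extChartAt 𝓘(ℝ, E) x₀) x v) = σ.form x ![u, v] := by
  refine (bilin_apply _ _ _).trans ((congrArg (σ.form.inChart x₀ _) ?_).trans
    (σ.form.inChart_mfderiv hx ![u, v]))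
  ext i
  fin_cases i <;> rfl

theorem contraction_mfderiv (σ : SymplecticForm E X) (W : VField E X) {x : X}
    (hx : x ∈ (extChartAt 𝓘(ℝ, E) x₀).source) (v : TangentSpace 𝓘(ℝ, E) x) :
    σ.contraction W x₀ (extChartAt 𝓘(ℝ, E) x₀ x)
      (mfderiv 𝓘(ℝ, E) 𝓘(ℝ, E) (extChartAt 𝓘(ℝ, E) x₀) x v) = σ.form x ![W x, v] := by
  rw [← σ.bilin_inChart_mfderiv hx, ← W.inChart_apply hx]
  rfl

theorem contDiffAt_contraction [CompleteSpace E] (σ : SymplecticForm E X) {W : VField E X} {y : E}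
    (hy : y ∈ (extChartAt 𝓘(ℝ, E) x₀).target)
    (hW : W.SmoothAt ((extChartAt 𝓘(ℝ, E) x₀).symm y)) :
    ContDiffAt ℝ ∞ (σ.contraction W x₀) y :=
  (σ.contDiffAt_bilin_inChart hy).clm_apply (hW.inChart hy)

/-- At its centre the preferred chart has the identity as derivative, so the pullback in the
definition of `DForm.d` disappears. -/
theorem extDeriv_inChart (σ : SymplecticForm E X) (x : X) :
    extDeriv (σ.form.inChart x) (extChartAt 𝓘(ℝ, E) x x) = 0 := by
  ext v
  have h : σ.form.d x v = 0 := by rw [σ.closed]; rfl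
  refine Eq.trans ?_ h
  refine congrArg (extDeriv (σ.form.inChart x) (extChartAt 𝓘(ℝ, E) x x)) (funext fun i ↦ ?_)
  have h := mfderiv_extChartAt_self (I := 𝓘(ℝ, E)) (x := x)
  exact (DFunLike.congr_fun h (v i)).symm

/-- A constant field is pulled back under the chart. Smoothness at `x` suffices for testing
`LieDerivEqZero`, so no cutoff function is needed. -/
theorem exists_smoothAt_inChart_eq [CompleteSpace E] (x : X) (u : E) :
    ∃ Y : VField E X, Y.SmoothAt x ∧ Y.inChart x (extChartAt 𝓘(ℝ, E) x x) = u := by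
  have hx := mem_extChartAt_source (I := 𝓘(ℝ, E)) x
  have hinv := isInvertible_mfderiv_extChartAt (I := 𝓘(ℝ, E)) hx
  refine ⟨VectorField.mpullback 𝓘(ℝ, E) 𝓘(ℝ, E) (extChartAt 𝓘(ℝ, E) x) (fun _ ↦ u), ?_, ?_⟩
  · refine ContMDiffAt.mpullback_vectorField_preimage (n := ∞) ?_ (contMDiffAt_chart hx) hinv
      (by simp)
    exact contMDiffAt_vectorSpace_iff_contDiffAt.2 contDiffAt_const
  · rw [VField.inChart_apply _ hx]
    exact (hinv.inverse_apply_eq.1 rfl).symm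

/-- A smooth vector field `W` satisfies `L_W σ = 0` if and only if `W ⌟ σ` is closed. -/
theorem lieDerivEqZero_iff [CompleteSpace E] (σ : SymplecticForm E X) {W : VField E X}
    (hW : W.Smooth) :
    LieDerivEqZero W σ.form ↔ ∀ (x : X) (u v : E),
      fderiv ℝ (σ.contraction W x) (extChartAt 𝓘(ℝ, E) x x) u v =
        fderiv ℝ (σ.contraction W x) (extChartAt 𝓘(ℝ, E) x x) v u := by
  have key (x : X) (Y : Fin 2 → VField E X) (hY : ∀ i, (Y i).SmoothAt x) :
      lieDeriv W σ.form Y x =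
        fderiv ℝ (σ.contraction W x) (extChartAt 𝓘(ℝ, E) x x)
            ((Y 0).inChart x (extChartAt 𝓘(ℝ, E) x x))
            ((Y 1).inChart x (extChartAt 𝓘(ℝ, E) x x)) -
          fderiv ℝ (σ.contraction W x) (extChartAt 𝓘(ℝ, E) x x)
            ((Y 1).inChart x (extChartAt 𝓘(ℝ, E) x x))
            ((Y 0).inChart x (extChartAt 𝓘(ℝ, E) x x)) := by
    have hp := mem_extChartAt_target (I := 𝓘(ℝ, E)) x
    have hdiff (V : VField E X) (hV : V.SmoothAt x) :
        DifferentiableAt ℝ (V.inChart x) (extChartAt 𝓘(ℝ, E) x x) := by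
      refine (VField.SmoothAt.inChart hp ?_).differentiableAt (by simp)
      rwa [extChartAt_to_inv]
    rw [lieDeriv_eq_inChart σ.smooth hY]
    exact lieDeriv_formula (Y := fun i ↦ (Y i).inChart x)
      ((σ.smooth.contDiffAt hp).differentiableAt (by simp)) (hdiff W (hW x))
      (fun i ↦ hdiff _ (hY i)) (σ.extDeriv_inChart x)
  constructor
  · intro h x u v
    obtain ⟨Y₀, hY₀, hu⟩ := exists_smoothAt_inChart_eq x u
    obtain ⟨Y₁, hY₁, hv⟩ := exists_smoothAt_inChart_eq x v
    have hY : ∀ i, (![Y₀, Y₁] i).SmoothAt x := by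
      intro i
      fin_cases i
      exacts [hY₀, hY₁]
    have h' := h x ![Y₀, Y₁] hY
    rw [key x _ hY, Matrix.cons_val_zero, Matrix.cons_val_one, Matrix.cons_val_zero, hu, hv] at h'
    exact sub_eq_zero.1 h'
  · intro h x Y hY
    rw [key x Y hY, h, sub_self]

/-- If `W ⌟ σ` is closed at every point in the chart at this point, then it is closed in all
charts. -/
theorem fderiv_contraction_symmetric [CompleteSpace E] (σ : SymplecticForm E X) {W : VField E X}
    (hW : W.Smooth)
    (h : ∀ (x : X) (u v : E),
      fderiv ℝ (σ.contraction W x) (extChartAt 𝓘(ℝ, E) x x) u v =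
        fderiv ℝ (σ.contraction W x) (extChartAt 𝓘(ℝ, E) x x) v u)
    {y : E} (hy : y ∈ (extChartAt 𝓘(ℝ, E) x₀).target) (u v : E) :
    fderiv ℝ (σ.contraction W x₀) y u v = fderiv ℝ (σ.contraction W x₀) y v u := by
  -- The hypothesis only concerns chart centres, so the chart centred at the point over `y` is used
  -- and the symmetry is pulled back along the transition map.
  set x := (extChartAt 𝓘(ℝ, E) x₀).symm y with hx
  have hxs := mem_extChartAt_source (I := 𝓘(ℝ, E)) x
  have hp := mem_extChartAt_target (I := 𝓘(ℝ, E)) x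
  have hτ : ContDiffAt ℝ ∞ (extChartAt 𝓘(ℝ, E) x ∘ (extChartAt 𝓘(ℝ, E) x₀).symm) y :=
    contMDiffAt_iff_contDiffAt.1 ((contMDiffAt_chart hxs).comp y (contMDiffAt_symm hy))
  refine fderiv_pullback_symmetric (β := σ.contraction W x) (hτ.of_le (by norm_cast))
    ((σ.contDiffAt_contraction hp ?_).differentiableAt (by simp)) ?_ (h x) u v
  · exact hW _
  · have h1 : ∀ᶠ z in 𝓝 y,
        (extChartAt 𝓘(ℝ, E) x₀).symm z ∈ (extChartAt 𝓘(ℝ, E) x).source :=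
      (contMDiffAt_symm hy).continuousAt.preimage_mem_nhds
        (extChartAt_source_mem_nhds (I := 𝓘(ℝ, E)) x)
    filter_upwards [h1, (isOpen_extChartAt_target x₀).mem_nhds hy] with z hz hzt
    ext w
    have hcomp := mfderiv_comp z ((contMDiffAt_chart hz).mdifferentiableAt (by simp))
      ((contMDiffAt_symm hzt).mdifferentiableAt (by simp))
    rw [mfderiv_eq_fderiv] at hcomp
    have h2 := σ.contraction_mfderiv W ((extChartAt 𝓘(ℝ, E) x₀).map_target hzt)
      (mfderiv 𝓘(ℝ, E) 𝓘(ℝ, E) (extChartAt 𝓘(ℝ, E) x₀).symm z w)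
    have h3 := σ.contraction_mfderiv W hz
      (mfderiv 𝓘(ℝ, E) 𝓘(ℝ, E) (extChartAt 𝓘(ℝ, E) x₀).symm z w)
    have h4 := DFunLike.congr_fun
      (congrArg (σ.contraction W x₀) ((extChartAt 𝓘(ℝ, E) x₀).right_inv hzt)) w
    have h5 := congrArg (σ.contraction W x₀ (extChartAt 𝓘(ℝ, E) x₀
      ((extChartAt 𝓘(ℝ, E) x₀).symm z))) (mfderiv_mfderiv_symm hzt w)
    have h6 := congrArg (σ.contraction W x (extChartAt 𝓘(ℝ, E) x
      ((extChartAt 𝓘(ℝ, E) x₀).symm z))) (DFunLike.congr_fun hcomp w)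
    -- In either chart the contraction, evaluated on the image of a tangent vector `v`, equals `σ(W,
    -- v)`.
    exact h4.symm.trans (h5.symm.trans (h2.trans (h3.symm.trans h6.symm)))

/-- If `W ⌟ σ` is closed, then `W` is locally Hamiltonian. -/
theorem isLocallyHamiltonian_of_symmetric [CompleteSpace E] (σ : SymplecticForm E X)
    {W : VField E X} (hW : W.Smooth)
    (h : ∀ (x : X) (u v : E),
      fderiv ℝ (σ.contraction W x) (extChartAt 𝓘(ℝ, E) x x) u v =
        fderiv ℝ (σ.contraction W x) (extChartAt 𝓘(ℝ, E) x x) v u) :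
    σ.IsLocallyHamiltonian W := by
  intro p
  -- A ball is convex, so the Poincaré lemma for `1`-forms applies on it.
  obtain ⟨r, hr, hball⟩ := Metric.isOpen_iff.1 (isOpen_extChartAt_target (I := 𝓘(ℝ, E)) p) _
    (mem_extChartAt_target (I := 𝓘(ℝ, E)) p)
  have hdiff : DifferentiableOn ℝ (σ.contraction W p)
      (Metric.ball (extChartAt 𝓘(ℝ, E) p p) r) := fun y hy ↦
    ((σ.contDiffAt_contraction (hball hy) (hW _)).differentiableAt
      (by simp)).differentiableWithinAt
  obtain ⟨g, hg⟩ := (convex_ball (extChartAt 𝓘(ℝ, E) p p) r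
    ).exists_forall_hasFDerivAt_of_fderiv_symmetric Metric.isOpen_ball hdiff
    (fun y hy ↦ σ.fderiv_contraction_symmetric hW h (hball hy))
  have hgs : ContDiffOn ℝ ∞ g (Metric.ball (extChartAt 𝓘(ℝ, E) p p) r) := by
    -- The primitive is smooth because its derivative, the contraction, is smooth.
    refine (contDiffOn_infty_iff_fderiv_of_isOpen Metric.isOpen_ball).2
      ⟨fun y hy ↦ (hg y hy).differentiableAt.differentiableWithinAt, ?_⟩
    refine ContDiffOn.congr (f := σ.contraction W p)
      (fun y hy ↦ (σ.contDiffAt_contraction (hball hy) (hW _)).contDiffWithinAt)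
      fun y hy ↦ (hg y hy).fderiv
  refine ⟨(extChartAt 𝓘(ℝ, E) p).source ∩
    extChartAt 𝓘(ℝ, E) p ⁻¹' Metric.ball (extChartAt 𝓘(ℝ, E) p p) r,
    g ∘ extChartAt 𝓘(ℝ, E) p, ⟨mem_extChartAt_source p, Metric.mem_ball_self hr⟩, ?_, ?_, ?_⟩
  · exact (continuousOn_extChartAt p).isOpen_inter_preimage (isOpen_extChartAt_source p)
      Metric.isOpen_ball
  · exact hgs.contMDiffOn.comp (fun x hx ↦ (contMDiffAt_chart hx.1).contMDiffWithinAt)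
      fun x hx ↦ hx.2
  · intro x hx
    ext v
    rw [interior_apply, diff_comp_chart hx.1 Filter.EventuallyEq.rfl (hg _ hx.2).differentiableAt,
      (hg _ hx.2).fderiv]
    exact (σ.contraction_mfderiv W hx.1 v).symm

end SymplecticForm

end Contraction

/-! ### Hamiltonian vector fields -/

section Hamiltonian

variable {E : Type*} [NormedAddCommGroup E] [NormedSpace ℝ E] [FiniteDimensional ℝ E]
  {X : Type*} [TopologicalSpace X] [ChartedSpace E X] {x₀ : X}

namespace SymplecticForm

theorem interior_hamVField (σ : SymplecticForm E X) (f : X → ℝ) (x : X) :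
    σ.interior x (σ.hamVField f x) = diff f x :=
  (LinearEquiv.ofBijective (σ.interior x) (σ.interior_bijective x)).apply_symm_apply _

theorem form_hamVField (σ : SymplecticForm E X) (f : X → ℝ) (x : X)
    (v : TangentSpace 𝓘(ℝ, E) x) : σ.form x ![σ.hamVField f x, v] = diff f x v := by
  rw [← interior_apply, interior_hamVField]

theorem eq_hamVField (σ : SymplecticForm E X) {f : X → ℝ} {x : X} {w : TangentSpace 𝓘(ℝ, E) x}
    (h : σ.interior x w = diff f x) : w = σ.hamVField f x :=
  (σ.interior_bijective x).injective (h.trans (σ.interior_hamVField f x).symm)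

theorem poisson_eq (σ : SymplecticForm E X) (f g : X → ℝ) (x : X) :
    σ.poisson f g x = -diff g x (σ.hamVField f x) := by
  rw [← form_hamVField]
  exact (bilin_apply (E := E) (σ.form x) _ _).symm.trans
    ((bilin_swap (E := E) (σ.form x) _ _).trans (congrArg _ (bilin_apply (E := E) (σ.form x) _ _)))

variable [IsManifold 𝓘(ℝ, E) ∞ X]

/-- Non-degeneracy passes to the chart as injectivity, and `E` and its dual have equal dimension. -/
theorem isInvertible_bilin_inChart (σ : SymplecticForm E X) {y : E}
    (hy : y ∈ (extChartAt 𝓘(ℝ, E) x₀).target) :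
    (bilin (σ.form.inChart x₀ y)).IsInvertible := by
  have hker : ∀ u, bilin (σ.form.inChart x₀ y) u = 0 → u = 0 := by
    intro u hu
    have h := σ.nondegenerate ((extChartAt 𝓘(ℝ, E) x₀).symm y)
      (mfderiv 𝓘(ℝ, E) 𝓘(ℝ, E) (extChartAt 𝓘(ℝ, E) x₀).symm y u) fun v ↦ ?_
    · have h' := mfderiv_mfderiv_symm hy u
      rw [h, map_zero] at h'
      exact h'.symm
    · refine (σ.bilin_inChart_mfderiv ((extChartAt 𝓘(ℝ, E) x₀).map_target hy) _ v).symm.trans ?_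
      have h1 := congrArg (fun z ↦ bilin (σ.form.inChart x₀ z))
        ((extChartAt 𝓘(ℝ, E) x₀).right_inv hy)
      refine (DFunLike.congr_fun (DFunLike.congr_fun h1 _) _).trans ?_
      have h2 := congrArg (bilin (σ.form.inChart x₀ y)) (mfderiv_mfderiv_symm hy u)
      exact DFunLike.congr_fun (h2.trans hu) _
  have hdim : Module.finrank ℝ E = Module.finrank ℝ (E →L[ℝ] ℝ) :=
    (Subspace.dual_finrank_eq (K := ℝ) (V := E)).symm.trans
      (LinearMap.toContinuousLinearMap (𝕜 := ℝ) (E := E) (F' := ℝ)).finrank_eq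
  have hinj : Function.Injective (bilin (σ.form.inChart x₀ y)).toLinearMap :=
    (injective_iff_map_eq_zero _).2 hker
  exact ⟨(LinearEquiv.ofInjectiveOfFinrankEq _ hinj hdim).toContinuousLinearEquiv, by ext; rfl⟩

theorem contraction_hamVField (σ : SymplecticForm E X) {f : X → ℝ}
    (hf : ContMDiff 𝓘(ℝ, E) 𝓘(ℝ, ℝ) ∞ f) {y : E} (hy : y ∈ (extChartAt 𝓘(ℝ, E) x₀).target) :
    σ.contraction (σ.hamVField f) x₀ y = fderiv ℝ (f ∘ (extChartAt 𝓘(ℝ, E) x₀).symm) y := by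
  obtain ⟨x, hx, rfl⟩ : ∃ x ∈ (extChartAt 𝓘(ℝ, E) x₀).source, extChartAt 𝓘(ℝ, E) x₀ x = y :=
    ⟨_, (extChartAt 𝓘(ℝ, E) x₀).map_target hy, (extChartAt 𝓘(ℝ, E) x₀).right_inv hy⟩
  ext u
  have hinv := isInvertible_mfderiv_extChartAt (I := 𝓘(ℝ, E)) hx
  have hu := hinv.inverse_apply_eq.1 (rfl : _ = (mfderiv 𝓘(ℝ, E) 𝓘(ℝ, E) _ x).inverse u)
  have h1 := (σ.contraction_mfderiv (σ.hamVField f) hx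
    ((mfderiv 𝓘(ℝ, E) 𝓘(ℝ, E) (extChartAt 𝓘(ℝ, E) x₀) x).inverse u)).trans (σ.form_hamVField f x _)
  rw [diff_comp_chart (g := f ∘ (extChartAt 𝓘(ℝ, E) x₀).symm) hx, ← hu] at h1
  · exact h1
  · filter_upwards [(isOpen_extChartAt_source (I := 𝓘(ℝ, E)) x₀).mem_nhds hx] with z hz
    exact (congrArg f ((extChartAt 𝓘(ℝ, E) x₀).left_inv hz)).symm
  · exact ((hf _).comp _ (contMDiffAt_symm hy)).contDiffAt.differentiableAt (by simp)

/-- The Hamiltonian vector field of a smooth function is smooth. -/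
theorem smooth_hamVField (σ : SymplecticForm E X) {f : X → ℝ}
    (hf : ContMDiff 𝓘(ℝ, E) 𝓘(ℝ, ℝ) ∞ f) : (σ.hamVField f).Smooth := by
  intro x
  have hx := mem_extChartAt_source (I := 𝓘(ℝ, E)) x
  have hp := mem_extChartAt_target (I := 𝓘(ℝ, E)) x
  have h1 : ContDiffAt ℝ ∞ ((σ.hamVField f).inChart x) (extChartAt 𝓘(ℝ, E) x x) := by
    have hfs : ContDiffAt ℝ ∞ (f ∘ (extChartAt 𝓘(ℝ, E) x).symm) (extChartAt 𝓘(ℝ, E) x x) :=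
      ((hf _).comp _ (contMDiffAt_symm hp)).contDiffAt
    -- In the chart, `V_f` is the inverse of the operator `u ↦ u ⌟ σ` applied to `df`; inversion is
    -- smooth at invertible operators.
    have h := ((σ.isInvertible_bilin_inChart hp).contDiffAt_map_inverse (n := ∞)).comp
      (extChartAt 𝓘(ℝ, E) x x) (σ.contDiffAt_bilin_inChart hp)
    refine (h.clm_apply (hfs.fderiv_right (m := ∞) (by simp))).congr_of_eventuallyEq ?_
    filter_upwards [(isOpen_extChartAt_target x).mem_nhds hp] with y hy
    exact ((σ.isInvertible_bilin_inChart hy).inverse_apply_eq.2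
      (σ.contraction_hamVField hf hy).symm).symm
  -- Near `x`, the field is the pullback of its representative under the chart.
  have h2 := ContMDiffAt.mpullback_vectorField_preimage (n := ∞) (m := ∞) (x₀ := x)
    (contMDiffAt_vectorSpace_iff_contDiffAt.2 h1) (contMDiffAt_chart hx)
    (isInvertible_mfderiv_extChartAt hx) (by simp)
  refine h2.congr_of_eventuallyEq ?_
  filter_upwards [extChartAt_source_mem_nhds (I := 𝓘(ℝ, E)) x] with z hz
  have h3 := (isInvertible_mfderiv_extChartAt (I := 𝓘(ℝ, E)) hz).inverse_apply_eq.2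
    ((σ.hamVField f).inChart_apply hz)
  exact congrArg (Bundle.TotalSpace.mk z) h3.symm

/-- In a chart `V_f ⌟ σ` is `df`, whose derivative is the symmetric second derivative of `f`. -/
theorem lieDerivEqZero_hamVField (σ : SymplecticForm E X) {f : X → ℝ}
    (hf : ContMDiff 𝓘(ℝ, E) 𝓘(ℝ, ℝ) ∞ f) : LieDerivEqZero (σ.hamVField f) σ.form := by
  refine (σ.lieDerivEqZero_iff (σ.smooth_hamVField hf)).2 fun x u v ↦ ?_
  have hp := mem_extChartAt_target (I := 𝓘(ℝ, E)) x
  have hfs : ContDiffAt ℝ ∞ (f ∘ (extChartAt 𝓘(ℝ, E) x).symm) (extChartAt 𝓘(ℝ, E) x x) :=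
    ((hf _).comp _ (contMDiffAt_symm hp)).contDiffAt
  have hev : σ.contraction (σ.hamVField f) x =ᶠ[𝓝 (extChartAt 𝓘(ℝ, E) x x)]
      fderiv ℝ (f ∘ (extChartAt 𝓘(ℝ, E) x).symm) := by
    filter_upwards [(isOpen_extChartAt_target x).mem_nhds hp] with y hy
    exact σ.contraction_hamVField hf hy
  rw [hev.fderiv_eq]
  exact (hfs.of_le (by norm_cast)).isSymmSndFDerivAt (n := 2) (by simp) u v

end SymplecticForm

end Hamiltonian

end HamiltonianMechanics

theorem theorem6p12 {E : Type*} [NormedAddCommGroup E] [NormedSpace ℝ E] [FiniteDimensional ℝ E]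
    {X : Type*} [TopologicalSpace X] [ChartedSpace E X] [IsManifold 𝓘(ℝ, E) ∞ X]
    (σ : HamiltonianMechanics.SymplecticForm E X)
    (H : X → ℝ) (hH : ContMDiff 𝓘(ℝ, E) 𝓘(ℝ, ℝ) ∞ H) :
    (∀ W : HamiltonianMechanics.VField E X, σ.IsContinuousSymmetry H W →
      σ.IsLocallyHamiltonian W ∧
      ∀ (U : Set X) (f : X → ℝ), σ.IsHamiltonianFunctionOn W f U →
        ∀ x ∈ U, W x = σ.hamVField f x ∧ σ.poisson f H x = 0) ∧
    (∀ f : X → ℝ, ContMDiff 𝓘(ℝ, E) 𝓘(ℝ, ℝ) ∞ f → (∀ x, σ.poisson f H x = 0) →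
      σ.IsContinuousSymmetry H (σ.hamVField f)) := by
  have : CompleteSpace E := FiniteDimensional.complete ℝ E
  refine ⟨fun W hW ↦ ⟨σ.isLocallyHamiltonian_of_symmetric hW.smooth
    ((σ.lieDerivEqZero_iff hW.smooth).1 hW.lieDeriv_form), fun U f hf x hx ↦ ?_⟩,
    fun f hf hfH ↦ ⟨σ.smooth_hamVField hf, σ.lieDerivEqZero_hamVField hf, fun x ↦ ?_⟩⟩
  · have h := σ.eq_hamVField (hf.interior_eq x hx)
    refine ⟨h, ?_⟩
    rw [σ.poisson_eq, ← h, neg_eq_zero]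
    exact hW.lieDeriv_fun x
  · have h := hfH x
    rwa [σ.poisson_eq, neg_eq_zero] at h
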